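/- Let $K$ be a field of characteristic different from $2$, let $\Gamma$ be a finite quiver (finite vertex set $\Gamma_0$, finite arrow set $\Gamma_1$) without oriented cycles, and let $\rho$ be a set of relations on $\Gamma$ over $K$, i.e. each $\sigma\in\rho$ is a $K$-linear combination of paths of length at least $2$ which all have the same source and all have the same target. Let $\Lambda=K(\Gamma,\rho)=K\Gamma/\langle\rho\rangle$. Here $K\Gamma$ is the path algebra, with basis all paths (including the trivial ones), where the product $xy$ of two paths is "first $y$, then $x$" if $y$ ends where $x$ starts, and $0$ otherwise. For each arrow $\alpha:j\to i$ of $\Gamma$ add a new arrow $\alpha^*:i\to j$, and let $\Gamma_1^*$ be the set of the new arrows; for a path $p=\alpha_n\cdots\alpha_1$ of $\Gamma$ put $p^*=\alpha_1^*\cdots\alpha_n^*$ (with $e_i^*=e_i$ for trivial paths), and extend $p\mapsto p^*$ linearly. The dual extension $\mathscr D(\Lambda)$ of $\Lambda$ is the quotient of the path algebra of the quiver $(\Gamma_0,\Gamma_1\cup\Gamma_1^*)$ by the two-sided ideal generated by $$\rho\ \cup\ \rho^*\ \cup\ \{\alpha\beta^*\mid \alpha,\beta\in\Gamma_1\}.$$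 Let $\Theta:\mathscr D(\Lambda)\to\mathscr D(\Lambda)$ be a Lie derivation, i.e. a $K$-linear map with $\Theta([a,b])=[\Theta(a),b]+[a,\Theta(b)]$ for all $a,b$, where $[a,b]=ab-ba$. Then $\Theta$ is of the standard form: there are a $K$-linear derivation $D$ of $\mathscr D(\Lambda)$ (that is, $D(ab)=D(a)b+aD(b)$ for all $a,b$) and a $K$-linear map $\Delta$ from $\mathscr D(\Lambda)$ to its center with $\Delta([a,b])=0$ for all $a,b$, such that $$\Theta=D+\Delta .$$ Moreover, the pair $(D,\Delta)$ is unique. -/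

import Mathlib

universe u v w

namespace QuiverAlg

/-- A path in a quiver, bundled with its source and its target. -/
structure QPath (V : Type u) [Quiver.{v + 1} V] where
  src : V
  tgt : V
  path : Quiver.Path src tgt

/-- A quiver has no oriented cycles: every path from a vertex to itself is trivial. -/
def HasNoOrientedCycles (V : Type u) [Quiver.{v + 1} V] : Prop :=
  ∀ (a : V) (p : Quiver.Path a a), p = Quiver.Path.nil

section PathAlgebra

/-- The path algebra `K V` of a quiver with vertex set `V`: the `K`-vector space with basis the set
of all paths (trivial ones included). -/
def PathAlgebra (K : Type w) [Field K] (V : Type u) [Quiver.{v + 1} V] : Type (max u (v + 1) w) :=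
  QPath V →₀ K

variable (K : Type w) [Field K] (V : Type u) [Quiver.{v + 1} V]

noncomputable instance : AddCommGroup (PathAlgebra K V) :=
  inferInstanceAs (AddCommGroup (QPath V →₀ K))

noncomputable instance : Module K (PathAlgebra K V) :=
  inferInstanceAs (Module K (QPath V →₀ K))

namespace PathAlgebra

variable {V}

/-- The basis element of the path algebra given by a path. -/
noncomputable def single (p : QPath V) : PathAlgebra K V := Finsupp.single p 1

/-- The paths as a basis of the path algebra. -/
noncomputable def pathBasis : Module.Basis (QPath V) K (PathAlgebra K V) :=
  ⟨LinearEquiv.refl K (QPath V →₀ K)⟩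

/-- The trivial path at a vertex, as an element of the path algebra. -/
noncomputable def vertex (a : V) : PathAlgebra K V := single K ⟨a, a, Quiver.Path.nil⟩

/-- An arrow, as an element of the path algebra. -/
noncomputable def arrow {a b : V} (f : a ⟶ b) : PathAlgebra K V := single K ⟨a, b, f.toPath⟩

open Classical in
/-- The product `p q` of two paths: first `q`, then `p`, if the target of `q` is the source of `p`,
and zero otherwise. -/
noncomputable def mulPath (p q : QPath V) : PathAlgebra K V :=
  if h : q.tgt = p.src then
    single K ⟨q.src, p.tgt, q.path.comp (p.path.cast h.symm rfl)⟩
  else 0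

/-- The multiplication of the path algebra: the bilinear extension of the product of paths. -/
noncomputable def mulHom : PathAlgebra K V →ₗ[K] PathAlgebra K V →ₗ[K] PathAlgebra K V :=
  (pathBasis K).constr K fun p => (pathBasis K).constr K fun q => mulPath K p q

noncomputable instance : Mul (PathAlgebra K V) := ⟨fun x y => mulHom K x y⟩

/-- The identity is the sum of the trivial paths. -/
noncomputable instance [Fintype V] : One (PathAlgebra K V) := ⟨∑ a : V, vertex K a⟩

variable {K}

theorem pathBasis_apply (p : QPath V) : pathBasis K p = single K p := rfl

theorem mul_def (x y : PathAlgebra K V) : x * y = mulHom K x y := rfl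

theorem one_def [Fintype V] : (1 : PathAlgebra K V) = ∑ a : V, vertex K a := rfl

theorem single_mul_single (p q : QPath V) : single K p * single K q = mulPath K p q := by
  rw [mul_def, ← pathBasis_apply, ← pathBasis_apply, mulHom, Module.Basis.constr_basis,
    Module.Basis.constr_basis]

theorem single_mul_single_comp {a b c : V} (p : Quiver.Path b c) (q : Quiver.Path a b) :
    single K ⟨b, c, p⟩ * single K ⟨a, b, q⟩ = single K ⟨a, c, q.comp p⟩ := by
  rw [single_mul_single, mulPath, dif_pos rfl]
  rfl

theorem single_mul_single_of_ne (p q : QPath V) (h : q.tgt ≠ p.src) :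
    single K p * single K q = 0 := by
  rw [single_mul_single, mulPath, dif_neg h]

theorem induction_on {P : PathAlgebra K V → Prop} (x : PathAlgebra K V) (zero : P 0)
    (add : ∀ x y, P x → P y → P (x + y)) (single : ∀ p, P (single K p))
    (smul : ∀ (c : K) x, P x → P (c • x)) : P x := by
  have hx : x ∈ Submodule.span K (Set.range (pathBasis (V := V) K)) := by
    rw [Module.Basis.span_eq]; trivial
  induction hx using Submodule.span_induction with
  | mem x h => obtain ⟨p, rfl⟩ := h; exact single p
  | zero => exact zero
  | add x y _ _ hx hy => exact add x y hx hy
  | smul c x _ hx => exact smul c x hx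

theorem smul_mul (c : K) (x y : PathAlgebra K V) : (c • x) * y = c • (x * y) := by
  simp only [mul_def, map_smul, LinearMap.smul_apply]

theorem mul_smul' (c : K) (x y : PathAlgebra K V) : x * (c • y) = c • (x * y) := by
  simp only [mul_def, map_smul]

theorem add_mul' (x y z : PathAlgebra K V) : (x + y) * z = x * z + y * z := by
  simp only [mul_def, map_add, LinearMap.add_apply]

theorem mul_add' (x y z : PathAlgebra K V) : x * (y + z) = x * y + x * z := by
  simp only [mul_def, map_add]

theorem zero_mul' (x : PathAlgebra K V) : 0 * x = 0 := by
  simp only [mul_def, map_zero, LinearMap.zero_apply]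

theorem mul_zero' (x : PathAlgebra K V) : x * 0 = 0 := by
  simp only [mul_def, map_zero]

theorem single_mul_assoc (p q r : QPath V) :
    single K p * single K q * single K r = single K p * (single K q * single K r) := by
  obtain ⟨a, b, p⟩ := p
  obtain ⟨c, d, q⟩ := q
  obtain ⟨e, f, r⟩ := r
  by_cases h₁ : d = a
  · subst h₁
    by_cases h₂ : f = c
    · subst h₂
      simp only [single_mul_single_comp, Quiver.Path.comp_assoc]
    · rw [single_mul_single_comp, single_mul_single_of_ne _ _ h₂,
        single_mul_single_of_ne _ _ h₂, mul_zero']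
  · rw [single_mul_single_of_ne _ _ h₁, zero_mul']
    by_cases h₂ : f = c
    · subst h₂
      rw [single_mul_single_comp, single_mul_single_of_ne _ _ h₁]
    · rw [single_mul_single_of_ne _ _ h₂, mul_zero']

theorem mul_assoc' (x y z : PathAlgebra K V) : x * y * z = x * (y * z) := by
  induction x using induction_on with
  | zero => simp only [zero_mul']
  | add x x' hx hx' => simp only [add_mul', hx, hx']
  | smul c x hx => simp only [smul_mul, hx]
  | single p =>
    induction y using induction_on with
    | zero => simp only [zero_mul', mul_zero']
    | add y y' hy hy' => simp only [add_mul', mul_add', hy, hy']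
    | smul c y hy => simp only [smul_mul, mul_smul', hy]
    | single q =>
      induction z using induction_on with
      | zero => simp only [mul_zero']
      | add z z' hz hz' => simp only [mul_add', hz, hz']
      | smul c z hz => simp only [mul_smul', hz]
      | single r => exact single_mul_assoc p q r

theorem one_mul' [Fintype V] (x : PathAlgebra K V) : 1 * x = x := by
  classical
  induction x using induction_on with
  | zero => exact mul_zero' _
  | add x y hx hy => rw [mul_add', hx, hy]
  | smul c x hx => rw [mul_smul', hx]
  | single p =>
    obtain ⟨a, b, p⟩ := p
    rw [one_def, mul_def, map_sum, LinearMap.sum_apply, Finset.sum_eq_single b]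
    · rw [← mul_def, vertex, single_mul_single_comp, Quiver.Path.comp_nil]
    · intro c _ hc
      rw [← mul_def, vertex, single_mul_single_of_ne _ _ hc.symm]
    · simp

theorem mul_one' [Fintype V] (x : PathAlgebra K V) : x * 1 = x := by
  classical
  induction x using induction_on with
  | zero => exact zero_mul' _
  | add x y hx hy => rw [add_mul', hx, hy]
  | smul c x hx => rw [smul_mul, hx]
  | single p =>
    obtain ⟨a, b, p⟩ := p
    rw [one_def, mul_def, map_sum, Finset.sum_eq_single a]
    · rw [← mul_def, vertex, single_mul_single_comp, Quiver.Path.nil_comp]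
    · intro c _ hc
      rw [← mul_def, vertex, single_mul_single_of_ne _ _ hc]
    · simp

noncomputable instance [Fintype V] : Ring (PathAlgebra K V) :=
  { (inferInstance : AddCommGroup (PathAlgebra K V)) with
    mul := (· * ·)
    one := 1
    zero_mul := zero_mul'
    mul_zero := mul_zero'
    left_distrib := mul_add'
    right_distrib := add_mul'
    mul_assoc := mul_assoc'
    one_mul := one_mul'
    mul_one := mul_one' }

noncomputable instance [Fintype V] : Algebra K (PathAlgebra K V) :=
  Algebra.ofModule smul_mul fun c x y => mul_smul' c x y

end PathAlgebra

end PathAlgebra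

section Relations

variable {K : Type w} [Field K] {V : Type u} [Quiver.{v + 1} V]

/-- A relation on a quiver: a linear combination of paths of length at least two which all have the
same source and all have the same target. -/
def IsRelation (σ : PathAlgebra K V) : Prop :=
  ∃ a b : V, σ ∈ Submodule.span K
    {x : PathAlgebra K V | ∃ p : Quiver.Path a b,
      2 ≤ p.length ∧ x = PathAlgebra.single K ⟨a, b, p⟩}

/-- The algebra `K(V, ρ)` of a quiver with relations: the quotient of the path algebra by the
two-sided ideal generated by `ρ`. -/
abbrev QuotAlgebra [Fintype V] (ρ : Set (PathAlgebra K V)) : Type (max u (v + 1) w) :=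
  (TwoSidedIdeal.span ρ).ringCon.Quotient

end Relations

section DualExtension

open Quiver

/-- The vertices of the doubled quiver `Symmetrify V` are those of `V`; its arrows `a ⟶ b` are the
arrows `α : a ⟶ b` of `V` (`Symmetrify.of.map α`) together with an arrow `α* : a ⟶ b`
(`reverse (Symmetrify.of.map α)`) for every arrow `α : b ⟶ a` of `V`. -/
instance (V : Type u) [h : Fintype V] : Fintype (Symmetrify V) := h

variable (K : Type w) [Field K] {V : Type u} [Quiver.{v + 1} V]

/-- A path of `V` viewed as a path of the doubled quiver. -/
def inclPath (p : QPath V) : QPath (Symmetrify V) :=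
  ⟨Symmetrify.of.obj p.src, Symmetrify.of.obj p.tgt, Symmetrify.of.mapPath p.path⟩

/-- The path `p* = α₁* ⋯ αₙ*` of the doubled quiver, for a path `p = αₙ ⋯ α₁` of `V`. -/
def starPath (p : QPath V) : QPath (Symmetrify V) :=
  ⟨Symmetrify.of.obj p.tgt, Symmetrify.of.obj p.src, (Symmetrify.of.mapPath p.path).reverse⟩

/-- The linear extension of `p ↦ p` to the path algebras. -/
noncomputable def inclMap : PathAlgebra K V →ₗ[K] PathAlgebra K (Symmetrify V) :=
  (PathAlgebra.pathBasis K).constr K fun p => PathAlgebra.single K (inclPath p)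

/-- The linear extension of `p ↦ p*` to the path algebras. -/
noncomputable def starMap : PathAlgebra K V →ₗ[K] PathAlgebra K (Symmetrify V) :=
  (PathAlgebra.pathBasis K).constr K fun p => PathAlgebra.single K (starPath p)

variable (V) in
/-- The elements `α β*` of the path algebra of the doubled quiver, for all arrows `α`, `β` of `V`
(the element is zero if `α` and `β` have different sources). -/
def arrowMulStar : Set (PathAlgebra K (Symmetrify V)) :=
  {x | ∃ (a b c d : V) (α : a ⟶ b) (β : c ⟶ d),
    x = PathAlgebra.arrow K (Symmetrify.of.map α) *
      PathAlgebra.arrow K (reverse (Symmetrify.of.map β))}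

variable {K}

/-- The relations `ρ ∪ ρ* ∪ {α β*}` of the dual extension. -/
def dualRelations (ρ : Set (PathAlgebra K V)) : Set (PathAlgebra K (Symmetrify V)) :=
  inclMap K '' ρ ∪ starMap K '' ρ ∪ arrowMulStar K V

/-- The dual extension of `K(V, ρ)`. -/
abbrev DualExtension [Fintype V] (ρ : Set (PathAlgebra K V)) : Type (max u (v + 1) w) :=
  QuotAlgebra (dualRelations ρ)

end DualExtension

section Derivations

variable {K : Type u} [Field K] {A : Type v} [Ring A] [Algebra K A]

/-- A linear map is an (associative) derivation. -/
def IsDerivation (D : A →ₗ[K] A) : Prop :=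
  ∀ a b : A, D (a * b) = D a * b + a * D b

/-- A linear map is a Lie derivation; here `⁅a, b⁆ = a * b - b * a`. -/
def IsLieDerivation (Θ : A →ₗ[K] A) : Prop :=
  ∀ a b : A, Θ ⁅a, b⁆ = ⁅Θ a, b⁆ + ⁅a, Θ b⁆

/-- `Θ = D + Δ` with a derivation `D` and a linear map `Δ` which has values in the center and
vanishes on all commutators. -/
def IsStandardDecomposition (Θ D Δ : A →ₗ[K] A) : Prop :=
  IsDerivation D ∧ (∀ a : A, Δ a ∈ Subalgebra.center K A) ∧ (∀ a b : A, Δ ⁅a, b⁆ = 0) ∧ Θ = D + Δ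

end Derivations

end QuiverAlg

namespace QuiverAlg

/-! ### Lie derivations and Peirce decompositions -/

section Peirce

variable {K : Type u} [Field K] {A : Type v} [Ring A] [Algebra K A]

/-! The relations `α β* = 0` make the dual extension `A` the span of the elements `r* s`, where `r`,
`s` are paths of `Γ` with a common target. Without oriented cycles this has three consequences. A
corner `e i A e i` is `K (e i)` plus the span of the `r* s` with `r`, `s` nontrivial. That span
squares to zero and consists of sums of products of off-diagonal Peirce components. For `i ≠ j`,
paths `i → j` and `j → i` cannot both exist, so one of `e i A e j A e i`, `e j A e i A e j`
vanishes. `IsAcyclicPeirce` records these facts, and the Lie theory uses nothing else.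

Existence: subtracting an inner derivation makes every `Θ (e i)` commute with all `e j`
(`exists_sub_commutator_diagonal`). Since `2 ≠ 0`, the result preserves off-diagonal components
(`offDiagonal`), and the values at the idempotents are then central because the corners are
commutative (`map_idempotent_central`). Subtracting `Δ a = ∑ ε a i • Θ (e i)` leaves a Lie
derivation killing all `e i`. It satisfies the Leibniz rule, because outside a single corner either
`ab` or `ba` vanishes by orthogonality or acyclicity (`isDerivation_of_map_idempotent`).

Uniqueness: two decompositions differ by a derivation with central values that vanishes on
commutators. It kills the idempotents, and everything else is a sum of commutators
(`isDerivation_eq_zero`). -/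

theorem IsDerivation.map_idempotent_eq_zero {D : A →ₗ[K] A} (hD : IsDerivation D) {e : A}
    (he : e * e = e) (hc : ∀ a, D e * a = a * D e) : D e = 0 := by
  have h : D e = D e * e + e * D e := by rw [← hD, he]
  have h2 : e * D e = 0 := by
    have h3 := congrArg (e * ·) h
    simp only [mul_add, hc e, ← mul_assoc, he] at h3
    simpa using h3
  rw [h, hc e, h2, add_zero]

theorem isDerivation_commutator (x : A) :
    IsDerivation (LinearMap.mulLeft K x - LinearMap.mulRight K x) := by
  intro a b
  simp only [LinearMap.sub_apply, LinearMap.mulLeft_apply, LinearMap.mulRight_apply]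
  noncomm_ring

theorem IsDerivation.add {D E : A →ₗ[K] A} (hD : IsDerivation D) (hE : IsDerivation E) :
    IsDerivation (D + E) := by
  intro a b
  simp only [LinearMap.add_apply, hD a b, hE a b]
  noncomm_ring

theorem IsDerivation.isLieDerivation {D : A →ₗ[K] A} (hD : IsDerivation D) :
    IsLieDerivation D := by
  intro a b
  simp only [Ring.lie_def, map_sub, hD a b, hD b a]
  noncomm_ring

theorem IsLieDerivation.sub {D E : A →ₗ[K] A} (hD : IsLieDerivation D) (hE : IsLieDerivation E) :
    IsLieDerivation (D - E) := by
  intro a b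
  rw [LinearMap.sub_apply, hD a b, hE a b]
  simp only [LinearMap.sub_apply, Ring.lie_def]
  noncomm_ring

theorem isLieDerivation_of_central {Δ : A →ₗ[K] A} (hc : ∀ a b, Δ a * b = b * Δ a)
    (hΔ : ∀ a b : A, Δ ⁅a, b⁆ = 0) : IsLieDerivation Δ := by
  intro a b
  rw [hΔ, Ring.lie_def, Ring.lie_def, hc, ← hc b a]
  simp

/-- A complete family of orthogonal idempotents `e` with an augmentation `ε` onto the span of the
`e i`, such that each corner `e i A e i` is `K (e i)` plus a square-zero part generated by
the products of off-diagonal Peirce components, and such that for `i ≠ j` one of the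
products `e i A e j A e i` and `e j A e i A e j` vanishes. -/
structure IsAcyclicPeirce {V : Type w} [Fintype V] [DecidableEq V] (e : V → A)
    (ε : A →ₐ[K] V → K) : Prop where
  idem : CompleteOrthogonalIdempotents e
  augment : ∀ i, ε (e i) = Pi.single i 1
  acyclic : ∀ i j, i ≠ j →
    (∀ x y, e i * x * e j * y * e i = 0) ∨ (∀ x y, e j * x * e i * y * e j = 0)
  loops : ∀ i a, ε a i = 0 → e i * a * e i ∈
    Submodule.span K {z | ∃ j, j ≠ i ∧ ∃ x y, z = e i * x * e j * y * e i}
  sq_zero : ∀ i a b, ε a i = 0 → ε b i = 0 → e i * a * e i * (e i * b * e i) = 0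

variable {V : Type w} [Fintype V] {e : V → A}

theorem eq_sum_peirce (he : CompleteOrthogonalIdempotents e) (a : A) :
    a = ∑ i, ∑ j, e i * a * e j := by
  simp only [← Finset.mul_sum, he.complete, mul_one]
  rw [← Finset.sum_mul, he.complete, one_mul]

theorem linearMap_ext_peirce (he : CompleteOrthogonalIdempotents e) {M : Type*} [AddCommGroup M]
    [Module K M] {f g : A →ₗ[K] M} (h : ∀ i j a, f (e i * a * e j) = g (e i * a * e j)) :
    f = g := by
  ext a
  rw [eq_sum_peirce he a]
  simp only [map_sum, h]

theorem central_of_peirce (he : CompleteOrthogonalIdempotents e) {d : A}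
    (h : ∀ i j a, d * (e i * a * e j) = e i * a * e j * d) (a : A) : d * a = a * d := by
  rw [eq_sum_peirce he a]
  simp only [Finset.mul_sum, Finset.sum_mul, h]

/-- Both sides of the Leibniz rule are bilinear, so they can be compared one Peirce component at a
time. -/
theorem isDerivation_of_peirce (he : CompleteOrthogonalIdempotents e) {D : A →ₗ[K] A}
    (h : ∀ i j k l a b, D (e i * a * e j * (e k * b * e l)) =
      D (e i * a * e j) * (e k * b * e l) + e i * a * e j * D (e k * b * e l)) :
    IsDerivation D := by
  have H : (LinearMap.mul K A).compr₂ D =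
      (LinearMap.mul K A).comp D + (LinearMap.mul K A).compl₂ D := by
    refine linearMap_ext_peirce he fun i j a => linearMap_ext_peirce he fun k l b => ?_
    simpa using h i j k l a b
  intro a b
  simpa using LinearMap.congr_fun (LinearMap.congr_fun H a) b

/-- A Lie derivation can be made to have diagonal values at the idempotents by subtracting an inner
derivation. -/
theorem IsLieDerivation.exists_sub_commutator_diagonal (he : CompleteOrthogonalIdempotents e)
    {Θ : A →ₗ[K] A} (hΘ : IsLieDerivation Θ) :
    ∃ x, ∀ i j, e j * (Θ (e i) - (x * e i - e i * x)) = (Θ (e i) - (x * e i - e i * x)) * e j := by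
  classical
  have hee : ∀ i j, e i * e j = if i = j then e i else 0 := he.mul_eq
  have key : ∀ i j, i ≠ j →
      Θ (e i) * e j - e j * Θ (e i) + (e i * Θ (e j) - Θ (e j) * e i) = 0 := by
    intro i j hij
    have h := hΘ (e i) (e j)
    rw [Ring.lie_def, he.ortho hij, he.ortho hij.symm, sub_zero, map_zero, Ring.lie_def,
      Ring.lie_def] at h
    exact h.symm
  have idem' : ∀ i z, e i * (e i * z) = e i * z := fun i z => by rw [← mul_assoc, he.idem]
  -- With this `x`, `key` gives `e i * x = 2 e i Θ(e i) e i - e i Θ(e i)`. Hence `Θ (e i) - [x, e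
  -- i]` is `e i Θ(e i) e i + (1 - e i) Θ(e i) (1 - e i)`.
  refine ⟨∑ l, Θ (e l) * e l, fun i => ?_⟩
  have hxe : (∑ l, Θ (e l) * e l) * e i = Θ (e i) * e i := by
    simp [Finset.sum_mul, mul_assoc, hee]
  have hex : e i * ∑ l, Θ (e l) * e l = e i * Θ (e i) * e i + e i * Θ (e i) * e i
      - e i * Θ (e i) := by
    have h (l : V) : e i * (Θ (e l) * e l) =
        (if l = i then e i * Θ (e i) * e i + e i * Θ (e i) * e i else 0)
          - e i * Θ (e i) * e l := by
      split_ifs with hl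
      · subst hl
        rw [mul_assoc]
        abel
      · have h := congrArg (fun z => e i * z * e l) (key i l (Ne.symm hl))
        simp only [mul_add, mul_sub, add_mul, sub_mul, mul_assoc, idem', he.ortho (Ne.symm hl),
          (he.idem l).eq, mul_zero, zero_mul, sub_zero] at h
        rw [← mul_assoc (e i) (e l), he.ortho (Ne.symm hl), zero_mul, sub_zero] at h
        rw [zero_sub, eq_neg_iff_add_eq_zero, ← h, mul_assoc, add_comm]
    rw [Finset.mul_sum, Finset.sum_congr rfl fun l _ => h l, Finset.sum_sub_distrib,
      ← Finset.mul_sum, he.complete, mul_one]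
    simp
  intro j
  rw [hxe, hex]
  by_cases hij : i = j
  · subst hij
    simp only [mul_add, mul_sub, add_mul, sub_mul, mul_assoc, idem', (he.idem i).eq]
    abel
  -- Compressing by `1 - e i` removes the `Θ (e j)` terms of `key`, leaving the commutator of `e j`
  -- with the compressed `Θ (e i)`.
  · have h := congrArg (fun z => (1 - e i) * z * (1 - e i)) (key i j hij)
    have hji (z : A) : e j * (e i * z) = 0 := by rw [← mul_assoc, he.ortho (Ne.symm hij), zero_mul]
    have hij' (z : A) : e i * (e j * z) = 0 := by rw [← mul_assoc, he.ortho hij, zero_mul]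
    simp only [mul_add, mul_sub, add_mul, sub_mul, mul_assoc, idem', (he.idem i).eq, mul_one,
      one_mul, he.ortho hij, he.ortho (Ne.symm hij), hji, hij', mul_zero, zero_mul] at h ⊢
    simp only [sub_self, sub_zero, zero_sub, add_zero, zero_add, sub_neg_eq_add] at h ⊢
    rw [← sub_eq_zero, ← neg_eq_zero, ← h]
    abel

/-- A Lie derivation with diagonal values at the idempotents preserves the off-diagonal Peirce
components. -/
theorem IsLieDerivation.offDiagonal (he : CompleteOrthogonalIdempotents e) (h2 : (2 : K) ≠ 0)
    {Θ : A →ₗ[K] A} (hΘ : IsLieDerivation Θ) (hd : ∀ i j, e j * Θ (e i) = Θ (e i) * e j)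
    {i j : V} (hij : i ≠ j) {b : A} (hib : e i * b = b) (hbj : b * e j = b) :
    e i * Θ b = Θ b ∧ Θ b * e j = Θ b ∧ ∀ k, Θ (e k) * b = b * Θ (e k) := by
  have half (z : A) (hz : z = -z) : z = 0 := by
    have : (2 : K) • z = 0 := by rw [two_smul]; nth_rw 1 [hz]; simp
    exact (smul_eq_zero.mp this).resolve_left h2
  have cancel (p u q : A) (h : p = u + (p - q)) : u = q := by
    rw [← sub_eq_zero, ← neg_eq_zero, ← sub_eq_zero.mpr h]
    abel
  have hbi : b * e i = 0 := by rw [← hbj, mul_assoc, he.ortho hij.symm, mul_zero]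
  have hjb : e j * b = 0 := by rw [← hib, ← mul_assoc, he.ortho hij.symm, zero_mul]
  -- Apply `Θ` to `b = [e i, b]`, and below to `b = [b, e j]`.
  have hl : Θ b = Θ (e i) * b - b * Θ (e i) + (e i * Θ b - Θ b * e i) := by
    simpa [Ring.lie_def, hib, hbi] using hΘ (e i) b
  have hr : Θ b = Θ b * e j - e j * Θ b + (b * Θ (e j) - Θ (e j) * b) := by
    simpa [Ring.lie_def, hjb, hbj] using hΘ b (e j)
  have hu : Θ (e i) * b - b * Θ (e i) = e i * Θ b * e i := by
    have h := congrArg (e i * ·) hl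
    simp only [mul_add, mul_sub, ← mul_assoc, hd, (he.idem i).eq, hib] at h
    rw [mul_assoc _ (e i) b, hib] at h
    exact cancel _ _ _ h
  -- By `hu` this is `[Θ (e i), b]`, which lies in `e i A e j`; multiplying by `e j` on the right
  -- fixes one side and kills the other.
  have hu0 : e i * Θ b * e i = 0 := by
    have h := congrArg (· * e j) hu
    simp only [sub_mul, mul_assoc, ← hd, hbj, he.ortho hij, mul_zero] at h
    rw [← mul_assoc b, hbj] at h
    rw [← hu, h]
  have hv : b * Θ (e j) - Θ (e j) * b = e j * Θ b * e j := by
    have h := congrArg (· * e j) hr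
    simp only [add_mul, sub_mul, mul_assoc, ← hd, (he.idem j).eq, hbj] at h
    rw [← mul_assoc b (e j), hbj] at h
    rw [mul_assoc]
    exact cancel _ _ _ (h.trans (add_comm _ _))
  have hv0 : e j * Θ b * e j = 0 := by
    have h := congrArg (e i * ·) hv
    simp only [mul_sub, ← mul_assoc, hd, hib, he.ortho hij, zero_mul] at h
    rw [mul_assoc _ (e i) b, hib] at h
    rw [← hv, h]
  rw [hu, hu0, zero_add] at hl
  rw [hv, hv0, add_zero] at hr
  -- Characteristic `≠ 2` enters here: the Lie rule only shows that `Θ b * e i` is its own negative.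
  have hi0 : Θ b * e i = 0 := half _ (by
    nth_rw 1 [hl]
    rw [sub_mul, hu0, mul_assoc, (he.idem i).eq, zero_sub])
  have hj0 : e j * Θ b = 0 := half _ (by
    nth_rw 1 [hr]
    rw [mul_sub, ← mul_assoc, hv0, ← mul_assoc, (he.idem j).eq, zero_sub])
  rw [hi0, sub_zero] at hl
  rw [hj0, sub_zero] at hr
  refine ⟨hl.symm, hr.symm, fun k => ?_⟩
  by_cases hki : k = i
  · subst hki
    exact sub_eq_zero.mp (hu.trans hu0)
  by_cases hkj : k = j
  · subst hkj
    exact (sub_eq_zero.mp (hv.trans hv0)).symm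
  have hkb : e k * b = 0 := by rw [← hib, ← mul_assoc, he.ortho hki, zero_mul]
  have hbk : b * e k = 0 := by rw [← hbj, mul_assoc, he.ortho (Ne.symm hkj), mul_zero]
  have hkX : e k * Θ b = 0 := by rw [hl, ← mul_assoc, he.ortho hki, zero_mul]
  have hXk : Θ b * e k = 0 := by rw [hr, mul_assoc, he.ortho (Ne.symm hkj), mul_zero]
  have h := hΘ (e k) b
  simp only [Ring.lie_def, hkb, hbk, hkX, hXk, sub_zero, map_zero, add_zero] at h
  exact sub_eq_zero.mp h.symm

/-! ### The standard form over an acyclic Peirce decomposition -/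

namespace IsAcyclicPeirce

variable [DecidableEq V] {ε : A →ₐ[K] V → K}

omit [Fintype V] [DecidableEq V] in
theorem augment_commutator (ε : A →ₐ[K] V → K) (a b : A) : ε ⁅a, b⁆ = 0 := by
  rw [Ring.lie_def, map_sub, map_mul, map_mul, mul_comm, sub_self]

theorem loop_eq (h : IsAcyclicPeirce e ε) (i : V) (a : A) :
    e i * a * e i = ε a i • e i + e i * (a - ε a i • 1) * e i := by
  simp [mul_sub, sub_mul, (h.idem.idem i).eq]

omit [Fintype V] [DecidableEq V] in
theorem augment_sub (ε : A →ₐ[K] V → K) (i : V) (a : A) : ε (a - ε a i • 1) i = 0 := by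
  simp

/-- A corner is made of scalars plus a square-zero part, so it is commutative. -/
theorem loop_mul_comm (h : IsAcyclicPeirce e ε) (i : V) (a b : A) :
    e i * a * e i * (e i * b * e i) = e i * b * e i * (e i * a * e i) := by
  rw [h.loop_eq i a, h.loop_eq i b]
  have h1 := h.sq_zero i _ _ (augment_sub ε i a) (augment_sub ε i b)
  have h2 := h.sq_zero i _ _ (augment_sub ε i b) (augment_sub ε i a)
  simp only [mul_add, add_mul, h1, h2]
  have hl (z : A) : e i * (e i * z * e i) = e i * z * e i := by
    rw [← mul_assoc, ← mul_assoc, (h.idem.idem i).eq]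
  have hr (z : A) : e i * z * e i * e i = e i * z * e i := by
    rw [mul_assoc, (h.idem.idem i).eq]
  simp only [smul_mul_assoc, mul_smul_comm, hl, hr, smul_comm (ε a i)]
  abel

theorem map_idempotent_central (h : IsAcyclicPeirce e ε) (h2 : (2 : K) ≠ 0)
    {Θ : A →ₗ[K] A} (hΘ : IsLieDerivation Θ) (hd : ∀ i j, e j * Θ (e i) = Θ (e i) * e j)
    (k : V) (a : A) : Θ (e k) * a = a * Θ (e k) := by
  refine central_of_peirce h.idem (fun i j a => ?_) a
  by_cases hij : i = j
  · subst hij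
    have hi := (h.idem.idem i).eq
    calc Θ (e k) * (e i * a * e i) = e i * Θ (e k) * e i * (e i * a * e i) := by
          simp only [hd, mul_assoc]
          simp only [← mul_assoc, hi]
      _ = e i * a * e i * (e i * Θ (e k) * e i) := h.loop_mul_comm i _ _
      _ = e i * a * e i * Θ (e k) := by
          rw [mul_assoc (e i) (Θ _), ← hd, ← mul_assoc (e i) (e i), hi, ← mul_assoc,
            mul_assoc _ (e i) (e i), hi]
  · exact (hΘ.offDiagonal h.idem h2 hd hij (by simp only [← mul_assoc, (h.idem.idem i).eq])
      (by rw [mul_assoc, (h.idem.idem j).eq])).2.2 k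

/-- The span of the products of off-diagonal Peirce components in the corner `e i A e i`. -/
def loopSpan (K : Type u) [Field K] {A : Type v} [Ring A] [Algebra K A] {V : Type w}
    (e : V → A) (i : V) : Submodule K A :=
  Submodule.span K {z | ∃ j, j ≠ i ∧ ∃ x y, z = e i * x * e j * y * e i}

/-- A linear map out of the augmentation part of a corner is controlled by its values on products
of off-diagonal elements. -/
theorem loop_induction (h : IsAcyclicPeirce e ε) {i : V} {f : A →ₗ[K] A} {p : Submodule K A}
    (hf : ∀ j, j ≠ i → ∀ x y, f (e i * x * e j * y * e i) ∈ p) {a : A} (ha : ε a i = 0) :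
    f (e i * a * e i) ∈ p := by
  have := h.loops i a ha
  rw [← Submodule.mem_comap]
  refine Submodule.span_le.mpr ?_ this
  rintro _ ⟨j, hj, x, y, rfl⟩
  exact hf j hj x y

theorem mem_loopSpan (h : IsAcyclicPeirce e ε) {i : V} {z : A} (hz : z ∈ loopSpan K e i) :
    e i * z * e i = z ∧ ε z i = 0 := by
  induction hz using Submodule.span_induction with
  | mem z hz =>
    obtain ⟨j, hj, x, y, rfl⟩ := hz
    refine ⟨?_, ?_⟩
    · simp only [← mul_assoc, (h.idem.idem i).eq]
      rw [mul_assoc _ (e i), (h.idem.idem i).eq]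
    · simp [h.augment, hj.symm]
  | zero => simp
  | add x y _ _ hx hy => simp [mul_add, add_mul, hx, hy]
  | smul c x _ hx => simp [hx]

theorem mul_eq_zero_of_mem_loopSpan (h : IsAcyclicPeirce e ε) {i : V} {y z : A}
    (hy : e i * y * e i = y ∧ ε y i = 0) (hz : e i * z * e i = z ∧ ε z i = 0) : y * z = 0 := by
  rw [← hy.1, ← hz.1, h.sq_zero i _ _ hy.2 hz.2]

/-- A Lie derivation which vanishes at the idempotents is a derivation. -/
theorem isDerivation_of_map_idempotent (h : IsAcyclicPeirce e ε) (h2 : (2 : K) ≠ 0)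
    {D : A →ₗ[K] A} (hD : IsLieDerivation D) (h0 : ∀ i, D (e i) = 0) : IsDerivation D := by
  have idem (i : V) : e i * e i = e i := (h.idem.idem i).eq
  have cl (i j : V) (a : A) : e i * (e i * a * e j) = e i * a * e j := by
    simp only [← mul_assoc, idem]
  have cr (i j : V) (a : A) : e i * a * e j * e j = e i * a * e j := by
    rw [mul_assoc, idem]
  have off (i j : V) (hij : i ≠ j) (a : A) : e i * D (e i * a * e j) = D (e i * a * e j) ∧
      D (e i * a * e j) * e j = D (e i * a * e j) := by
    have := hD.offDiagonal h.idem h2 (by simp [h0]) hij (cl i j a) (cr i j a)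
    exact ⟨this.1, this.2.1⟩
  have vanish (i j : V) (hji : ∀ x y, e j * x * e i * y * e j = 0) (p q : A) (h1 : e j * p = p)
      (h2 : p * e i = p) (h4 : q * e j = q) : p * q = 0 := by
    rw [← hji p q, h1, h2, mul_assoc, h4]
  -- When the products in the reverse order vanish, the Lie rule for `[a, b]` is the Leibniz rule
  -- for `a * b`.
  have leibniz (a b : A) (h1 : b * a = 0) (h2 : b * D a = 0) (h3 : D b * a = 0) :
      D (a * b) = D a * b + a * D b := by
    simpa [Ring.lie_def, h1, h2, h3] using hD a b
  have mem (i j : V) (hji : j ≠ i) (x y : A) (h1 : x * e j = x) (h2 : e i * x = x)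
      (h3 : y * e i = y) : x * y ∈ loopSpan K e i :=
    Submodule.subset_span ⟨j, hji, x, y, by rw [h2, h1, mul_assoc, h3]⟩
  have split (i j : V) (x y : A) :
      e i * x * e j * y * e i = e i * x * e j * (e j * y * e i) := by
    rw [mul_assoc (e j), ← mul_assoc _ (e j), cr, mul_assoc _ y]
  -- On an off-diagonal product `x y`, either `x y = 0`, or `y x = 0` and `D (x y) = D x y + x D y`
  -- is again a sum of such products.
  have loop (i : V) (a : A) (ha : ε a i = 0) : D (e i * a * e i) ∈ loopSpan K e i := by
    refine h.loop_induction (fun j hj x y => ?_) ha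
    obtain hz | hz := h.acyclic i j hj.symm
    · rw [hz, map_zero]
      exact zero_mem _
    · rw [split, leibniz _ _ (vanish i j hz _ _ (cl _ _ _) (cr _ _ _) (cr _ _ _))
        (vanish i j hz _ _ (cl _ _ _) (cr _ _ _) (off i j hj.symm x).2)
        (vanish i j hz _ _ (off j i hj y).1 (off j i hj y).2 (cr _ _ _))]
      exact add_mem (mem i j hj _ _ (off i j hj.symm x).2 (off i j hj.symm x).1 (cr _ _ _))
        (mem i j hj _ _ (cr _ _ _) (cl _ _ _) (off j i hj y).2)
  have Dloop (i : V) (a : A) : D (e i * a * e i) = D (e i * (a - ε a i • 1) * e i) := by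
    rw [h.loop_eq i a, map_add, map_smul, h0, smul_zero, zero_add]
  have peirce (i j : V) (a : A) : e i * D (e i * a * e j) = D (e i * a * e j) ∧
      D (e i * a * e j) * e j = D (e i * a * e j) := by
    by_cases hij : i = j
    · subst hij
      have := (h.mem_loopSpan (loop i _ (augment_sub ε i a))).1
      rw [Dloop, ← this]
      exact ⟨cl _ _ _, cr _ _ _⟩
    · exact off i j hij a
  have kill (j k : V) (hjk : j ≠ k) (x y : A) (hx : x * e j = x) (hy : e k * y = y) :
      x * y = 0 := by
    rw [← hx, ← hy, mul_assoc, ← mul_assoc (e j), h.idem.ortho hjk, zero_mul, mul_zero]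
  refine isDerivation_of_peirce h.idem fun i j k l a b => ?_
  by_cases hjk : j = k
  swap
  · rw [kill j k hjk _ _ (cr _ _ _) (cl _ _ _), kill j k hjk _ _ (peirce i j a).2 (cl _ _ _),
      kill j k hjk _ _ (cr _ _ _) (peirce k l b).1, map_zero, add_zero]
  subst hjk
  by_cases hil : i = l
  swap
  · have hli := Ne.symm hil
    exact leibniz _ _ (kill l i hli _ _ (cr _ _ _) (cl _ _ _))
      (kill l i hli _ _ (cr _ _ _) (peirce i j a).1) (kill l i hli _ _ (peirce j l b).2 (cl _ _ _))
  subst hil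
  by_cases hij : i = j
  · subst hij
    have ha := loop i _ (augment_sub ε i a)
    have hb := loop i _ (augment_sub ε i b)
    have hna : e i * (e i * (a - ε a i • 1) * e i) * e i = e i * (a - ε a i • 1) * e i ∧
        ε (e i * (a - ε a i • 1) * e i) i = 0 := ⟨by rw [cl, cr], by simp⟩
    have hnb : e i * (e i * (b - ε b i • 1) * e i) * e i = e i * (b - ε b i • 1) * e i ∧
        ε (e i * (b - ε b i • 1) * e i) i = 0 := ⟨by rw [cl, cr], by simp⟩
    rw [Dloop i a, Dloop i b, h.loop_eq i a, h.loop_eq i b]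
    -- In a single corner, write the factors as `α e i + m` and `β e i + n`. All of `m n`, `D m n`,
    -- `m D n` vanish, so both sides become `α D n + β D m`.
    have e1 := h.mul_eq_zero_of_mem_loopSpan (h.mem_loopSpan ha) hnb
    have e2 := h.mul_eq_zero_of_mem_loopSpan hna (h.mem_loopSpan hb)
    have e3 := h.mul_eq_zero_of_mem_loopSpan hna hnb
    have e4 := peirce i i (a - ε a i • 1)
    have e5 := peirce i i (b - ε b i • 1)
    have e6 := cl i i (b - ε b i • 1)
    have e7 := cr i i (a - ε a i • 1)
    generalize e i * (a - ε a i • 1) * e i = m at *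
    generalize e i * (b - ε b i • 1) * e i = n at *
    simp only [mul_add, add_mul, e1, e2, e3, smul_mul_assoc, mul_smul_comm, e4.2, e5.1, e6, e7,
      map_add, map_smul, idem, h0, smul_zero, zero_add, add_zero]
  -- Either every term of the Leibniz rule vanishes, or the reversed products do.
  obtain hz | hz := h.acyclic i j hij
  · rw [vanish j i hz _ _ (cl _ _ _) (cr _ _ _) (cr _ _ _),
      vanish j i hz _ _ (peirce i j a).1 (peirce i j a).2 (cr _ _ _),
      vanish j i hz _ _ (cl _ _ _) (cr _ _ _) (peirce j i b).2, map_zero, add_zero]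
  · exact leibniz _ _ (vanish i j hz _ _ (cl _ _ _) (cr _ _ _) (cr _ _ _))
      (vanish i j hz _ _ (cl _ _ _) (cr _ _ _) (peirce i j a).2)
      (vanish i j hz _ _ (peirce j i b).1 (peirce j i b).2 (cr _ _ _))

theorem exists_isStandardDecomposition (h : IsAcyclicPeirce e ε) (h2 : (2 : K) ≠ 0)
    {Θ : A →ₗ[K] A} (hΘ : IsLieDerivation Θ) :
    ∃ D Δ : A →ₗ[K] A, IsStandardDecomposition Θ D Δ := by
  obtain ⟨x, hx⟩ := hΘ.exists_sub_commutator_diagonal h.idem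
  have hI := isDerivation_commutator (K := K) x
  set I := LinearMap.mulLeft K x - LinearMap.mulRight K x with hI_def
  have hΨ := hΘ.sub hI.isLieDerivation
  have hc := h.map_idempotent_central h2 hΨ (by simpa [hI_def] using hx)
  set Ψ := Θ - I with hΨ_def
  -- Chosen to agree with `Ψ` at each `e i`; it kills commutators because `ε` has commutative
  -- target.
  let Δ : A →ₗ[K] A := ∑ i, ((LinearMap.proj i).comp ε.toLinearMap).smulRight (Ψ (e i))
  have hΔ (a : A) : Δ a = ∑ i, ε a i • Ψ (e i) := by simp [Δ]
  have hΔc (a b : A) : Δ a * b = b * Δ a := by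
    simp only [hΔ, Finset.sum_mul, Finset.mul_sum, smul_mul_assoc, mul_smul_comm, hc]
  have hΔ0 (a b : A) : Δ ⁅a, b⁆ = 0 := by simp [hΔ, augment_commutator]
  have hD : IsDerivation (Ψ - Δ) := by
    refine h.isDerivation_of_map_idempotent h2
      (hΨ.sub (isLieDerivation_of_central hΔc hΔ0)) fun i => ?_
    rw [LinearMap.sub_apply, hΔ, h.augment]
    simp [Pi.single_apply]
  refine ⟨Ψ - Δ + I, Δ, hD.add hI, fun a => Subalgebra.mem_center_iff.mpr fun b => ?_, hΔ0, ?_⟩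
  · exact (hΔc a b).symm
  · rw [hΨ_def]
    abel

/-- A central derivation which vanishes on commutators is zero. -/
theorem isDerivation_eq_zero (h : IsAcyclicPeirce e ε) {D : A →ₗ[K] A} (hD : IsDerivation D)
    (hc : ∀ a b, D a * b = b * D a) (h0 : ∀ a b : A, D ⁅a, b⁆ = 0) : D = 0 := by
  have comm (a b : A) (hba : b * a = 0) : D (a * b) = 0 := by
    simpa [Ring.lie_def, hba] using h0 a b
  have he (i : V) : D (e i) = 0 := hD.map_idempotent_eq_zero (h.idem.idem i).eq (hc _)
  refine linearMap_ext_peirce h.idem fun i j a => ?_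
  rw [LinearMap.zero_apply]
  by_cases hij : i = j
  · subst hij
    rw [h.loop_eq, map_add, map_smul, he, smul_zero, zero_add, ← Submodule.mem_bot K]
    refine h.loop_induction (fun j hj x y => (Submodule.mem_bot K).mpr ?_) (augment_sub ε i a)
    obtain hz | hz := h.acyclic i j hj.symm
    · rw [hz, map_zero]
    -- Doubling `e j` splits the loop into two off-diagonal factors whose reversed product is zero,
    -- so the loop is a commutator.
    · rw [← (h.idem.idem j).eq, ← mul_assoc, mul_assoc _ (e j) y, mul_assoc _ (e j * y)]
      apply comm
      simpa only [← mul_assoc, mul_assoc _ (e i) (e i), (h.idem.idem i).eq] using hz y x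
  · rw [mul_assoc]
    apply comm
    rw [mul_assoc, h.idem.ortho (Ne.symm hij), mul_zero]

theorem existsUnique_isStandardDecomposition (h : IsAcyclicPeirce e ε) (h2 : (2 : K) ≠ 0)
    {Θ : A →ₗ[K] A} (hΘ : IsLieDerivation Θ) :
    ∃! P : (A →ₗ[K] A) × (A →ₗ[K] A), IsStandardDecomposition Θ P.1 P.2 := by
  obtain ⟨D, Δ, hD, hc, h0, hs⟩ := h.exists_isStandardDecomposition h2 hΘ
  refine ⟨(D, Δ), ⟨hD, hc, h0, hs⟩, ?_⟩
  rintro ⟨D', Δ'⟩ ⟨hD', hc', h0', hs'⟩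
  have hsub : D' - D = Δ - Δ' := by
    rw [sub_eq_sub_iff_add_eq_add, ← hs', add_comm, hs, add_comm]
  have hd : IsDerivation (D' - D) := by
    intro a b
    rw [LinearMap.sub_apply, hD' a b, hD a b]
    simp only [LinearMap.sub_apply]
    noncomm_ring
  have hz : D' - D = 0 := by
    refine h.isDerivation_eq_zero hd (fun a b => ?_) fun a b => ?_
    · rw [hsub]
      exact (Subalgebra.mem_center_iff.mp (sub_mem (hc a) (hc' a)) b).symm
    · rw [hsub, LinearMap.sub_apply, h0, h0', sub_zero]
  rw [Prod.mk.injEq]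
  exact ⟨sub_eq_zero.mp hz, (sub_eq_zero.mp (hsub.symm.trans hz)).symm⟩

end IsAcyclicPeirce

end Peirce

end QuiverAlg


namespace QuiverAlg

/-! ### The augmentation of a path algebra -/

section Augmentation

variable (K : Type w) [Field K] (W : Type u) [Quiver.{v + 1} W]

open Classical in
/-- The value of the augmentation of the path algebra at a path. -/
noncomputable def pathAugmentation (p : QPath W) : W → K :=
  if p.path.length = 0 then Pi.single p.src 1 else 0

variable {W} in
theorem pathAugmentation_of_length_ne_zero {p : QPath W} (hp : p.path.length ≠ 0) :
    pathAugmentation K W p = 0 := if_neg hp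

variable {W} in
theorem pathAugmentation_nil [DecidableEq W] (a : W) :
    pathAugmentation K W ⟨a, a, Quiver.Path.nil⟩ = Pi.single a 1 := by
  simp only [pathAugmentation, Quiver.Path.length_nil, if_true]
  congr!

/-- The linear extension of `pathAugmentation`. -/
noncomputable def augmentationLinear : PathAlgebra K W →ₗ[K] W → K :=
  (PathAlgebra.pathBasis K).constr K (pathAugmentation K W)

theorem augmentationLinear_single (p : QPath W) :
    augmentationLinear K W (PathAlgebra.single K p) = pathAugmentation K W p := by
  rw [augmentationLinear, ← PathAlgebra.pathBasis_apply, Module.Basis.constr_basis]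

theorem augmentationLinear_single_mul (p q : QPath W) :
    augmentationLinear K W (PathAlgebra.single K p * PathAlgebra.single K q) =
      pathAugmentation K W p * pathAugmentation K W q := by
  classical
  obtain ⟨b', c, p⟩ := p
  obtain ⟨a, b, q⟩ := q
  by_cases h : b = b'
  · subst h
    rw [PathAlgebra.single_mul_single_comp, augmentationLinear_single]
    simp only [pathAugmentation, Quiver.Path.length_comp, Nat.add_eq_zero_iff]
    by_cases hq : q.length = 0
    · obtain rfl := Quiver.Path.eq_of_length_zero q hq
      by_cases hp : p.length = 0
      · simp [hp, hq, ← Pi.single_mul]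
      · simp [hp]
    · simp [hq]
  · rw [PathAlgebra.single_mul_single_of_ne _ _ h, map_zero]
    simp only [pathAugmentation]
    split_ifs with hp hq
    -- Two non-composable trivial paths sit at different vertices, so their indicator functions have
    -- product zero.
    · rw [Quiver.Path.eq_of_length_zero q hq]
      ext i
      by_cases hi : i = b
      · subst hi
        simp [h]
      · simp [hi]
    all_goals simp

variable [Fintype W]

/-- The augmentation of the path algebra, which kills all arrows. -/
noncomputable def augmentation : PathAlgebra K W →ₐ[K] W → K :=
  AlgHom.ofLinearMap (augmentationLinear K W)
    (by
      classical
      rw [PathAlgebra.one_def, map_sum]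
      simp only [PathAlgebra.vertex, augmentationLinear_single, pathAugmentation_nil]
      exact Finset.univ_sum_single 1)
    (by
      intro x y
      induction x using PathAlgebra.induction_on with
      | zero => simp
      | add x x' hx hx' => simp only [add_mul, map_add, hx, hx']
      | smul c x hx => simp only [smul_mul_assoc, map_smul, hx]
      | single p =>
        induction y using PathAlgebra.induction_on with
        | zero => simp
        | add y y' hy hy' => simp only [mul_add, map_add, hy, hy']
        | smul c y hy => simp only [mul_smul_comm, map_smul, hy]
        | single q =>
          simp only [augmentationLinear_single_mul, augmentationLinear_single])

theorem augmentation_single (p : QPath W) :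
    augmentation K W (PathAlgebra.single K p) = pathAugmentation K W p :=
  augmentationLinear_single K W p

end Augmentation

/-! ### Peirce decomposition of the dual extension -/

section DualExtension

open Quiver

variable {K : Type w} [Field K] {V : Type u} [Quiver.{v + 1} V]

theorem length_mapPath_of {a b : V} (p : Path a b) :
    (Symmetrify.of.mapPath p).length = p.length := by
  induction p with
  | nil => rfl
  | cons p f ih => exact congrArg (· + 1) ih

theorem length_reverse {W : Type*} [Quiver W] [HasReverse W] {a b : W} (p : Path a b) :
    p.reverse.length = p.length := by
  induction p with
  | nil => rfl
  | cons p f ih => simp [Path.reverse, ih, add_comm]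

theorem inclMap_single (p : QPath V) :
    inclMap K (PathAlgebra.single K p) = PathAlgebra.single K (inclPath p) := by
  rw [inclMap, ← PathAlgebra.pathBasis_apply, Module.Basis.constr_basis]

theorem starMap_single (p : QPath V) :
    starMap K (PathAlgebra.single K p) = PathAlgebra.single K (starPath p) := by
  rw [starMap, ← PathAlgebra.pathBasis_apply, Module.Basis.constr_basis]

theorem IsRelation.map_eq_zero {σ : PathAlgebra K V} (hσ : IsRelation σ) {M : Type*}
    [AddCommGroup M] [Module K M] (f : PathAlgebra K V →ₗ[K] M)
    (hf : ∀ p : QPath V, p.path.length ≠ 0 → f (PathAlgebra.single K p) = 0) : f σ = 0 := by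
  obtain ⟨a, b, hσ⟩ := hσ
  have : Submodule.span K {x : PathAlgebra K V | ∃ p : Quiver.Path a b,
      2 ≤ p.length ∧ x = PathAlgebra.single K ⟨a, b, p⟩} ≤ LinearMap.ker f := by
    rw [Submodule.span_le]
    rintro _ ⟨p, hp, rfl⟩
    exact hf _ (by dsimp only; omega)
  exact this hσ

variable [Fintype V] (ρ : Set (PathAlgebra K V))

theorem augmentation_dualRelations (hρ : ∀ σ ∈ ρ, IsRelation σ) {x : PathAlgebra K (Symmetrify V)}
    (hx : x ∈ dualRelations ρ) : augmentation K (Symmetrify V) x = 0 := by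
  obtain (⟨σ, hσ, rfl⟩ | ⟨σ, hσ, rfl⟩) | ⟨a, b, c, d, α, β, rfl⟩ := hx
  · refine (hρ σ hσ).map_eq_zero ((augmentation K (Symmetrify V)).toLinearMap ∘ₗ inclMap K)
      fun p hp => ?_
    rw [LinearMap.comp_apply, inclMap_single]
    refine (augmentation_single K _ _).trans (pathAugmentation_of_length_ne_zero K ?_)
    rwa [inclPath, length_mapPath_of]
  · refine (hρ σ hσ).map_eq_zero ((augmentation K (Symmetrify V)).toLinearMap ∘ₗ starMap K)
      fun p hp => ?_
    rw [LinearMap.comp_apply, starMap_single]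
    refine (augmentation_single K _ _).trans (pathAugmentation_of_length_ne_zero K ?_)
    rwa [starPath, length_reverse, length_mapPath_of]
  · rw [map_mul, PathAlgebra.arrow, augmentation_single,
      pathAugmentation_of_length_ne_zero K (by exact Nat.succ_ne_zero 0), zero_mul]

namespace DualExtension

/-- The quotient map onto the dual extension. -/
noncomputable def mk : PathAlgebra K (Symmetrify V) →ₐ[K] DualExtension ρ :=
  RingCon.mkₐ K (TwoSidedIdeal.span (dualRelations ρ)).ringCon

theorem mk_surjective : Function.Surjective (mk ρ) :=
  RingCon.mkₐ_surjective (α := K) _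

theorem mk_eq_zero {x : PathAlgebra K (Symmetrify V)} (hx : x ∈ dualRelations ρ) : mk ρ x = 0 :=
  (RingCon.eq _).mpr (TwoSidedIdeal.subset_span hx)

/-- The augmentation of the dual extension, which kills all arrows. -/
noncomputable def aug (hρ : ∀ σ ∈ ρ, IsRelation σ) : DualExtension ρ →ₐ[K] V → K :=
  RingCon.liftₐ _ (augmentation K (Symmetrify V)) (by
    have : TwoSidedIdeal.span (dualRelations ρ) ≤
        TwoSidedIdeal.ker (augmentation K (Symmetrify V)) :=
      TwoSidedIdeal.span_le.mpr fun x hx =>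
        (TwoSidedIdeal.mem_ker _).mpr (augmentation_dualRelations ρ hρ hx)
    exact TwoSidedIdeal.ringCon_le_iff.mp this)

theorem aug_mk (hρ : ∀ σ ∈ ρ, IsRelation σ) (x : PathAlgebra K (Symmetrify V)) :
    aug ρ hρ (mk ρ x) = augmentation K (Symmetrify V) x := rfl

/-- The idempotent of the dual extension at a vertex. -/
noncomputable def idem (a : V) : DualExtension ρ :=
  mk ρ (PathAlgebra.vertex K (Symmetrify.of.obj a))

/-- The class of a path `p` in the dual extension. -/
noncomputable def fwd {a b : V} (p : Path a b) : DualExtension ρ :=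
  mk ρ (PathAlgebra.single K (inclPath ⟨a, b, p⟩))

/-- The class of `p*` in the dual extension. -/
noncomputable def bwd {a b : V} (p : Path a b) : DualExtension ρ :=
  mk ρ (PathAlgebra.single K (starPath ⟨a, b, p⟩))

theorem fwd_nil (a : V) : fwd ρ (Path.nil : Path a a) = idem ρ a := rfl

theorem bwd_nil (a : V) : bwd ρ (Path.nil : Path a a) = idem ρ a := rfl

theorem fwd_comp {a b c : V} (p : Path a b) (q : Path b c) :
    fwd ρ (p.comp q) = fwd ρ q * fwd ρ p := by
  simp only [fwd, ← map_mul, inclPath, Prefunctor.mapPath_comp]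
  rw [PathAlgebra.single_mul_single_comp]

theorem bwd_comp {a b c : V} (p : Path a b) (q : Path b c) :
    bwd ρ (p.comp q) = bwd ρ p * bwd ρ q := by
  simp only [bwd, ← map_mul, starPath, Prefunctor.mapPath_comp, Path.reverse_comp]
  rw [PathAlgebra.single_mul_single_comp]

theorem fwd_arrow_mul_bwd_arrow {a b c d : V} (α : a ⟶ b) (β : c ⟶ d) :
    fwd ρ α.toPath * bwd ρ β.toPath = 0 := by
  rw [fwd, bwd, ← map_mul]
  exact mk_eq_zero ρ (Or.inr ⟨a, b, c, d, α, β, rfl⟩)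

/-- In `p q*` the first arrow of `p` meets the star of the first arrow of `q`, and that product is a
defining relation. -/
theorem fwd_mul_bwd {a b c d : V} (p : Path a b) (q : Path c d) (hp : p.length ≠ 0)
    (hq : q.length ≠ 0) : fwd ρ p * bwd ρ q = 0 := by
  obtain ⟨m, hm⟩ := Nat.exists_eq_succ_of_ne_zero hp
  obtain ⟨n, hn⟩ := Nat.exists_eq_succ_of_ne_zero hq
  obtain ⟨x, f, p, -, rfl⟩ := p.eq_toPath_comp_of_length_eq_succ hm
  obtain ⟨y, g, q, -, rfl⟩ := q.eq_toPath_comp_of_length_eq_succ hn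
  rw [fwd_comp, bwd_comp, mul_assoc, ← mul_assoc (fwd ρ f.toPath), fwd_arrow_mul_bwd_arrow,
    zero_mul, mul_zero]

theorem idem_mul_bwd {a b : V} (p : Path a b) : idem ρ a * bwd ρ p = bwd ρ p := by
  rw [← bwd_nil, ← bwd_comp, Path.nil_comp]

theorem bwd_mul_idem {a b : V} (p : Path a b) : bwd ρ p * idem ρ b = bwd ρ p := by
  rw [← bwd_nil, ← bwd_comp, Path.comp_nil]

theorem idem_mul_fwd {a b : V} (p : Path a b) : idem ρ b * fwd ρ p = fwd ρ p := by
  rw [← fwd_nil, ← fwd_comp, Path.comp_nil]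

theorem fwd_mul_idem {a b : V} (p : Path a b) : fwd ρ p * idem ρ a = fwd ρ p := by
  rw [← fwd_nil, ← fwd_comp, Path.nil_comp]

theorem idem_mul_idem (a : V) : idem ρ a * idem ρ a = idem ρ a :=
  fwd_mul_idem ρ Path.nil

theorem idem_mul_idem_of_ne {a b : V} (h : a ≠ b) : idem ρ a * idem ρ b = 0 := by
  rw [idem, idem, ← map_mul, PathAlgebra.vertex, PathAlgebra.vertex,
    PathAlgebra.single_mul_single_of_ne _ _ (Ne.symm h), map_zero]

theorem completeOrthogonalIdempotents : CompleteOrthogonalIdempotents (idem ρ) where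
  idem := idem_mul_idem ρ
  ortho _ _ h := idem_mul_idem_of_ne ρ h
  complete := by
    have h := congrArg (mk ρ) (PathAlgebra.one_def (K := K) (V := Symmetrify V))
    rw [map_one, map_sum] at h
    exact h.symm

/-- The span of the elements `r* s`, where `r` is a path starting at `i`, and `s` is a path starting
at `j` with the same target. -/
noncomputable def peirceSpan (i j : V) : Submodule K (DualExtension ρ) :=
  Submodule.span K {z | ∃ (l : V) (r : Path i l) (s : Path j l), z = bwd ρ r * fwd ρ s}

theorem mk_single_mem_peirceSpan {a b : Symmetrify V} (p : Path a b) :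
    mk ρ (PathAlgebra.single K ⟨a, b, p⟩) ∈ peirceSpan ρ (show V from b) (show V from a) := by
  induction p with
  | nil => exact Submodule.subset_span ⟨a, Path.nil, Path.nil, (idem_mul_idem ρ (a : V)).symm⟩
  | @cons b c p f ih =>
    have hf : mk ρ (PathAlgebra.single K ⟨a, c, p.cons f⟩) =
        mk ρ (PathAlgebra.single K ⟨b, c, f.toPath⟩) * mk ρ (PathAlgebra.single K ⟨a, b, p⟩) := by
      rw [← map_mul, PathAlgebra.single_mul_single_comp]
      rfl
    rw [hf]
    generalize mk ρ (PathAlgebra.single K ⟨a, b, p⟩) = z at ih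
    induction ih using Submodule.span_induction with
    | zero => rw [mul_zero]; exact zero_mem _
    | add x y _ _ hx hy => rw [mul_add]; exact add_mem hx hy
    | smul k x _ hx => rw [mul_smul_comm]; exact Submodule.smul_mem _ _ hx
    | mem z hz =>
      obtain ⟨l, r, s, rfl⟩ := hz
      rw [← mul_assoc]
      -- An arrow of `V` on the left of `r* s` kills it unless `r` is trivial, and is then absorbed
      -- into `s`; a starred arrow extends `r*`.
      obtain f | f := f
      · change fwd ρ (Hom.toPath (show (show V from b) ⟶ (show V from c) from f)) * _ * _ ∈ _
        by_cases hr : r.length = 0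
        · obtain rfl := Path.eq_of_length_zero r hr
          obtain rfl := Path.eq_nil_of_length_zero r hr
          rw [bwd_nil, fwd_mul_idem, ← fwd_comp, ← idem_mul_fwd, ← bwd_nil]
          exact Submodule.subset_span ⟨_, _, _, rfl⟩
        · rw [fwd_mul_bwd _ _ _ (by exact Nat.succ_ne_zero 0) hr, zero_mul]
          exact zero_mem _
      · change bwd ρ (Hom.toPath (show (show V from c) ⟶ (show V from b) from f)) * _ * _ ∈ _
        rw [← bwd_comp]
        exact Submodule.subset_span ⟨_, _, _, rfl⟩

theorem peirce_mem_peirceSpan (i j : V) (a : DualExtension ρ) :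
    idem ρ i * a * idem ρ j ∈ peirceSpan ρ i j := by
  obtain ⟨x, rfl⟩ := mk_surjective ρ a
  induction x using PathAlgebra.induction_on with
  | zero => simp
  | add x y hx hy => simpa only [map_add, mul_add, add_mul] using add_mem hx hy
  | smul c x hx =>
    simpa only [map_smul, mul_smul_comm, smul_mul_assoc] using Submodule.smul_mem _ c hx
  | single p =>
    obtain ⟨a, b, p⟩ := p
    rw [idem, idem, ← map_mul, ← map_mul, PathAlgebra.vertex, PathAlgebra.vertex]
    by_cases hb : Symmetrify.of.obj i = b
    · subst hb
      rw [PathAlgebra.single_mul_single_comp]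
      by_cases ha : Symmetrify.of.obj j = a
      · subst ha
        rw [PathAlgebra.single_mul_single_comp, Path.nil_comp]
        exact mk_single_mem_peirceSpan ρ _
      · rw [PathAlgebra.single_mul_single_of_ne _ _ ha, map_zero]
        exact zero_mem _
    · rw [PathAlgebra.single_mul_single_of_ne _ _ (Ne.symm hb), zero_mul, map_zero]
      exact zero_mem _

variable {ρ} in
theorem mul_eq_zero_of_span {S T : Set (DualExtension ρ)} (h : ∀ x ∈ S, ∀ y ∈ T, x * y = 0)
    {x y : DualExtension ρ} (hx : x ∈ Submodule.span K S) (hy : y ∈ Submodule.span K T) :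
    x * y = 0 := by
  induction hx, hy using Submodule.span_induction₂ with
  | mem_mem x y hx hy => exact h x hx y hy
  | zero_left => rw [zero_mul]
  | zero_right => rw [mul_zero]
  | add_left x y z _ _ _ h₁ h₂ => rw [add_mul, h₁, h₂, add_zero]
  | add_right x y z _ _ _ h₁ h₂ => rw [mul_add, h₁, h₂, add_zero]
  | smul_left c x y _ _ h => rw [smul_mul_assoc, h, smul_zero]
  | smul_right c x y _ _ h => rw [mul_smul_comm, h, smul_zero]

/-- In `(r* s)(r'* s')` the middle `s r'*` survives only if `s` or `r'` is trivial at `j`; then `r`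
or `s'` would be a path from `i` to `j`. -/
theorem peirce_mul_peirce_eq_zero {i j : V} (h : IsEmpty (Path i j))
    (x y : DualExtension ρ) : idem ρ i * x * idem ρ j * y * idem ρ i = 0 := by
  have hx := peirce_mem_peirceSpan ρ i j x
  have hy := peirce_mem_peirceSpan ρ j i y
  have hs : idem ρ i * x * idem ρ j * y * idem ρ i =
      idem ρ i * x * idem ρ j * (idem ρ j * y * idem ρ i) := by
    simp only [mul_assoc]
    rw [← mul_assoc (idem ρ j) (idem ρ j), idem_mul_idem]
  rw [hs]
  refine mul_eq_zero_of_span ?_ hx hy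
  rintro _ ⟨l, r, s, rfl⟩ _ ⟨l', r', s', rfl⟩
  rw [mul_assoc, ← mul_assoc (fwd ρ s), fwd_mul_bwd, zero_mul, mul_zero]
  · intro hs
    obtain rfl := Path.eq_of_length_zero s hs
    exact h.false r
  · intro hr
    obtain rfl := Path.eq_of_length_zero r' hr
    exact h.false s'

variable {ρ} in
theorem exists_loop_decomposition (hV : HasNoOrientedCycles V) {i : V} {z : DualExtension ρ}
    (hz : z ∈ peirceSpan ρ i i) :
    ∃ (c : K), z - c • idem ρ i ∈ Submodule.span K {z | ∃ l, l ≠ i ∧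
      ∃ (r : Path i l) (s : Path i l), z = bwd ρ r * fwd ρ s} := by
  induction hz using Submodule.span_induction with
  | zero => exact ⟨0, by simp⟩
  | add x y _ _ hx hy =>
    obtain ⟨c, hc⟩ := hx
    obtain ⟨d, hd⟩ := hy
    refine ⟨c + d, ?_⟩
    rw [add_smul, add_sub_add_comm]
    exact add_mem hc hd
  | smul k x _ hx =>
    obtain ⟨c, hc⟩ := hx
    refine ⟨k * c, ?_⟩
    rw [mul_smul, ← smul_sub]
    exact Submodule.smul_mem _ _ hc
  | mem x hx =>
    obtain ⟨l, r, s, rfl⟩ := hx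
    by_cases hl : l = i
    · subst hl
      refine ⟨1, ?_⟩
      rw [hV l r, hV l s, bwd_nil, fwd_nil, idem_mul_idem, one_smul, sub_self]
      exact zero_mem _
    · refine ⟨0, ?_⟩
      rw [zero_smul, sub_zero]
      exact Submodule.subset_span ⟨l, hl, r, s, rfl⟩

variable {ρ} in
theorem aug_bwd (hρ : ∀ σ ∈ ρ, IsRelation σ) {a b : V} (p : Path a b) (hp : p.length ≠ 0) :
    aug ρ hρ (bwd ρ p) = 0 := by
  rw [bwd, aug_mk, augmentation_single]
  refine pathAugmentation_of_length_ne_zero K ?_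
  rwa [starPath, length_reverse, length_mapPath_of]

theorem aug_idem [DecidableEq V] (hρ : ∀ σ ∈ ρ, IsRelation σ) (i : V) :
    aug ρ hρ (idem ρ i) = Pi.single i 1 := by
  rw [idem, aug_mk, PathAlgebra.vertex, augmentation_single]
  exact @pathAugmentation_nil K _ (Symmetrify V) _ ‹DecidableEq V› i

theorem loop_mem_span (hV : HasNoOrientedCycles V) (hρ : ∀ σ ∈ ρ, IsRelation σ) (i : V)
    {a : DualExtension ρ} (ha : aug ρ hρ a i = 0) :
    idem ρ i * a * idem ρ i ∈ Submodule.span K {z | ∃ l, l ≠ i ∧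
      ∃ (r : Path i l) (s : Path i l), z = bwd ρ r * fwd ρ s} := by
  classical
  obtain ⟨c, hc⟩ := exists_loop_decomposition hV (peirce_mem_peirceSpan ρ i i a)
  have hle : Submodule.span K {z | ∃ l, l ≠ i ∧
      ∃ (r : Path i l) (s : Path i l), z = bwd ρ r * fwd ρ s} ≤
        LinearMap.ker (aug ρ hρ).toLinearMap := by
    rw [Submodule.span_le]
    rintro _ ⟨l, hl, r, s, rfl⟩
    have hr : r.length ≠ 0 := fun h => hl (Path.eq_of_length_zero r h).symm
    change aug ρ hρ (bwd ρ r * fwd ρ s) = 0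
    rw [map_mul, aug_bwd hρ r hr, zero_mul]
  -- The augmentation kills every `r* s` with `r` nontrivial, so it reads off the scalar `c`.
  have h0 : aug ρ hρ (idem ρ i * a * idem ρ i - c • idem ρ i) i = 0 := congrFun (hle hc) i
  have hc0 : c = 0 := by simpa [aug_idem, ha] using h0
  simpa [hc0] using hc

theorem isAcyclicPeirce [DecidableEq V] (hV : HasNoOrientedCycles V)
    (hρ : ∀ σ ∈ ρ, IsRelation σ) : IsAcyclicPeirce (idem ρ) (aug ρ hρ) where
  idem := completeOrthogonalIdempotents ρ
  augment := aug_idem ρ hρ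
  acyclic i j hij := by
    by_cases h : IsEmpty (Path i j)
    · exact Or.inl (peirce_mul_peirce_eq_zero ρ h)
    · refine Or.inr (peirce_mul_peirce_eq_zero ρ ⟨fun q => ?_⟩)
      obtain ⟨p⟩ := not_isEmpty_iff.mp h
      -- Paths in both directions would compose to an oriented cycle.
      have hpq := congrArg Path.length (hV i (p.comp q))
      rw [Path.length_comp, Path.length_nil] at hpq
      exact hij (Path.eq_of_length_zero p (by omega))
  loops i a ha := by
    refine Submodule.span_mono ?_ (loop_mem_span ρ hV hρ i ha)
    rintro _ ⟨l, hl, r, s, rfl⟩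
    refine ⟨l, hl, bwd ρ r, fwd ρ s, ?_⟩
    rw [idem_mul_bwd, bwd_mul_idem, mul_assoc, fwd_mul_idem]
  sq_zero i a b ha hb := by
    refine mul_eq_zero_of_span ?_ (loop_mem_span ρ hV hρ i ha) (loop_mem_span ρ hV hρ i hb)
    rintro _ ⟨l, hl, r, s, rfl⟩ _ ⟨l', hl', r', s', rfl⟩
    rw [mul_assoc, ← mul_assoc (fwd ρ s), fwd_mul_bwd, zero_mul, mul_zero]
    · exact fun h => hl (Path.eq_of_length_zero s h).symm
    · exact fun h => hl' (Path.eq_of_length_zero r' h).symm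

end DualExtension

end DualExtension

end QuiverAlg

theorem theorem4p3 {K : Type w} [Field K] (hK : ringChar K ≠ 2)
    {V : Type u} [Quiver.{v + 1} V] [Fintype V] [∀ a b : V, Finite (a ⟶ b)]
    (hV : QuiverAlg.HasNoOrientedCycles V)
    (ρ : Set (QuiverAlg.PathAlgebra K V)) (hρ : ∀ σ ∈ ρ, QuiverAlg.IsRelation σ)
    (Θ : QuiverAlg.DualExtension ρ →ₗ[K] QuiverAlg.DualExtension ρ)
    (hΘ : QuiverAlg.IsLieDerivation Θ) :
    ∃! P : (QuiverAlg.DualExtension ρ →ₗ[K] QuiverAlg.DualExtension ρ) ×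
        (QuiverAlg.DualExtension ρ →ₗ[K] QuiverAlg.DualExtension ρ),
      QuiverAlg.IsStandardDecomposition Θ P.1 P.2 := by
  classical
  exact (QuiverAlg.DualExtension.isAcyclicPeirce ρ hV hρ).existsUnique_isStandardDecomposition
    (Ring.two_ne_zero hK) hΘ
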